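/- Equip $\mathbb{R}^{d+1}=\mathbb{R}\times\mathbb{R}^d$ with the norm $\|(a,v)\|^2=a^2+\|v\|^2$. A function $f\colon\mathbb{R}^d\to\mathbb{R}$ is called piecewise affine if there are finitely many polyhedral sets $Q_1,\dots,Q_k$ (finite intersections of closed halfspaces) with nonempty, mutually disjoint interiors and with $\bigcup_i Q_i=\mathbb{R}^d$, such that $f$ is affine on each $Q_i$. Let $f\colon\mathbb{R}^d\to\mathbb{R}$ be piecewise affine and bounded below. Then $f$ attains a global minimum, and there exist finite nonempty families $(a_i,v_i)_{i\in I}$, $(b_j,w_j)_{j\in J}$ in $\mathbb{R}^{d+1}$ such that $$f(x)=\underline f(x)+\overline f(x),\qquad \underline f(x)=\max_{i\in I}(a_i+\langle v_i,x\rangle),\quad \overline f(x)=\min_{j\in J}(b_j+\langle w_j,x\rangle)\qquad\forall x\in\mathbb{R}^d.$$ For any such representation put $$\underline d f(x)=\mathrm{co}\{(a_i-\underline f(x)+\langle v_i,x\rangle,\,v_i) : i\in I\},\qquad z_j(x)=(b_j-\overline f(x)+\langle w_j,x\rangle,\,w_j),$$ and let $(a_j(x),v_j(x))$ be the element of least norm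 of $\underline d f(x)+z_j(x)$, $j\in J$. Then the following holds. (1) Let $\{x_n\}_{n\ge 0}$ be any sequence such that for all $n$ one has $f(x_{n+1})\le f(x_n)$ and $$f(x_{n+1})\le f\Big(x_n+\frac1{a_j(x_n)}v_j(x_n)\Big)\qquad\text{for every } j\in J \text{ with } a_j(x_n)<0.$$ Then there is $N$ such that for all $n\ge N$ one has $a_j(x_n)\ge 0$ for all $j\in J$, and $x_n$ is a global minimizer of $f$. (2) Consider the method of codifferential descent with $\mu=+\infty$ and with $\{z_j(x) : j\in J\}$ as its set of hyperdifferential points: given $x_n$, for each $z\in\{z_j(x_n) : j\in J\}$ let $(a_n(z),v_n(z))$ be the element of least norm of $\underline d f(x_n)+z$, let $\alpha_n(z)\ge 0$ minimize $\alpha\mapsto f(x_n-\alpha v_n(z))$ over $\alpha\ge 0$, let $z_n$ minimize $f(x_n-\alpha_n(z)v_n(z))$ over $z\in\{z_j(x_n) : j\in J\}$, and set $x_{n+1}=x_n-\alpha_n(z_n)v_n(z_n)$. For every starting point $x_0$ the method generates a sequence (all the minima involved are attained), and for every sequence $\{x_n\}$ generated by it there is $N$ such that for all $n\ge N$ one has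 $a_j(x_n)\ge0$ for all $j\in J$, and $x_n$ is a global minimizer of $f$. -/

import Mathlib

namespace PiecewiseAffine

open Set

/-- The space `ℝ^d` with its Euclidean norm. -/
abbrev E (d : ℕ) : Type := EuclideanSpace ℝ (Fin d)

/-- The space `ℝ × ℝ^d = ℝ^{d+1}` of pairs `(a, v)` with `‖(a, v)‖² = a² + ‖v‖²`. -/
abbrev EPlus (d : ℕ) : Type := WithLp 2 (ℝ × E d)

/-- The pair `(a, v)` as an element of `ℝ^{d+1}`. -/
abbrev pair {d : ℕ} (a : ℝ) (v : E d) : EPlus d := WithLp.toLp 2 (a, v)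

/-! ### Piecewise affine functions -/

/-- A polyhedral set: the intersection of a finite family of closed halfspaces. -/
def IsPolyhedral {d : ℕ} (Q : Set (E d)) : Prop :=
  ∃ (m : ℕ) (u : Fin m → E d) (c : Fin m → ℝ),
    (∀ i, u i ≠ 0) ∧ Q = {x | ∀ i, inner ℝ (u i) x ≤ c i}

/-- A polyhedral partition of `ℝ^d`: finitely many polyhedral sets with nonempty, mutually disjoint
interiors that cover the space. -/
structure IsPolyhedralPartition {d k : ℕ} (Q : Fin k → Set (E d)) : Prop where
  polyhedral : ∀ i, IsPolyhedral (Q i)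
  cover : (⋃ i, Q i) = univ
  interior_nonempty : ∀ i, (interior (Q i)).Nonempty
  interior_disjoint : ∀ i j, i ≠ j → Disjoint (interior (Q i)) (interior (Q j))

/-- `f` is piecewise affine: it is affine on each member of some polyhedral partition. -/
def IsPiecewiseAffine {d : ℕ} (f : E d → ℝ) : Prop :=
  ∃ (k : ℕ) (Q : Fin k → Set (E d)), IsPolyhedralPartition Q ∧
    ∀ i, ∃ g : E d →ᵃ[ℝ] ℝ, EqOn f g (Q i)

/-! ### DC decompositions and global codifferentials -/

/-- The coefficients `(a_i, v_i)`, `i ∈ I`, and `(b_j, w_j)`, `j ∈ J`, of a function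
`x ↦ max_i (a_i + ⟨v_i, x⟩) + min_j (b_j + ⟨w_j, x⟩)`, with finite nonempty `I` and `J`. -/
structure DCData (d : ℕ) where
  l : ℕ
  s : ℕ
  l_pos : 0 < l
  s_pos : 0 < s
  a : Fin l → ℝ
  v : Fin l → E d
  b : Fin s → ℝ
  w : Fin s → E d

namespace DCData

variable {d : ℕ} (D : DCData d)

theorem univ_nonempty_I : (Finset.univ : Finset (Fin D.l)).Nonempty := ⟨⟨0, D.l_pos⟩, by simp⟩

theorem univ_nonempty_J : (Finset.univ : Finset (Fin D.s)).Nonempty := ⟨⟨0, D.s_pos⟩, by simp⟩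

/-- The convex part `max_i (a_i + ⟨v_i, x⟩)`. -/
noncomputable def convexPart (x : E d) : ℝ :=
  Finset.univ.sup' D.univ_nonempty_I fun i => D.a i + inner ℝ (D.v i) x

/-- The concave part `min_j (b_j + ⟨w_j, x⟩)`. -/
noncomputable def concavePart (x : E d) : ℝ :=
  Finset.univ.inf' D.univ_nonempty_J fun j => D.b j + inner ℝ (D.w j) x

/-- `D` is a DC decomposition of `f`. -/
def Represents (f : E d → ℝ) : Prop :=
  ∀ x, f x = D.convexPart x + D.concavePart x

/-- The global hypodifferential at `x`. -/
noncomputable def hypodiff (x : E d) : Set (EPlus d) :=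
  convexHull ℝ (range fun i => pair (D.a i - D.convexPart x + inner ℝ (D.v i) x) (D.v i))

/-- The generators `z_j(x)` of the global hyperdifferential at `x`. -/
noncomputable def z (j : Fin D.s) (x : E d) : EPlus d :=
  pair (D.b j - D.concavePart x + inner ℝ (D.w j) x) (D.w j)

end DCData

/-- The translate `C + z`. -/
def translate {d : ℕ} (C : Set (EPlus d)) (z : EPlus d) : Set (EPlus d) := (fun p => p + z) '' C

/-- `p` is an element of `C` of least norm. -/
def IsLeastNorm {d : ℕ} (C : Set (EPlus d)) (p : EPlus d) : Prop :=
  p ∈ C ∧ ∀ q ∈ C, ‖p‖ ≤ ‖q‖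

namespace DCData

variable {d : ℕ} (D : DCData d)

theorem exists_isLeastNorm (j : Fin D.s) (x : E d) :
    ∃ p, IsLeastNorm (translate (D.hypodiff x) (D.z j x)) p := by
  have hc : IsCompact (translate (D.hypodiff x) (D.z j x)) :=
    ((Set.finite_range _).isCompact_convexHull (𝕜 := ℝ)).image
      (continuous_id.add continuous_const)
  have hne : (translate (D.hypodiff x) (D.z j x)).Nonempty :=
    Set.Nonempty.image _ ⟨_, subset_convexHull ℝ _ ⟨⟨0, D.l_pos⟩, rfl⟩⟩
  obtain ⟨p, hp, hmin⟩ := hc.exists_isMinOn hne continuous_norm.continuousOn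
  exact ⟨p, hp, fun q hq => hmin hq⟩

/-- The pair `(a_j(x), v_j(x))`: the element of least norm of `hypodiff x + z_j(x)`. -/
noncomputable def nearest (j : Fin D.s) (x : E d) : EPlus d :=
  Classical.choose (D.exists_isLeastNorm j x)

theorem nearest_isLeastNorm (j : Fin D.s) (x : E d) :
    IsLeastNorm (translate (D.hypodiff x) (D.z j x)) (D.nearest j x) :=
  Classical.choose_spec (D.exists_isLeastNorm j x)

/-- The element of least norm is unique, so `nearest` does not depend on any choice. -/
theorem eq_nearest (j : Fin D.s) (x : E d) (p : EPlus d)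
    (hp : IsLeastNorm (translate (D.hypodiff x) (D.z j x)) p) : p = D.nearest j x := by
  by_contra hne
  have hq := D.nearest_isLeastNorm j x
  have hconv : Convex ℝ (translate (D.hypodiff x) (D.z j x)) := by
    have h := (convex_convexHull ℝ (range fun i =>
      pair (D.a i - D.convexPart x + inner ℝ (D.v i) x) (D.v i))).translate (D.z j x)
    have e : translate (D.hypodiff x) (D.z j x) = (fun p => D.z j x + p) '' D.hypodiff x := by
      unfold translate
      congr 1
      funext p
      exact add_comm _ _
    rw [e]
    exact h
  have hm := hconv hp.1 hq.1 (by norm_num : (0 : ℝ) ≤ 1 / 2) (by norm_num : (0 : ℝ) ≤ 1 / 2)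
    (by norm_num)
  have hlt := norm_combo_lt_of_ne (hp.2 _ hq.1) le_rfl hne (by norm_num : (0 : ℝ) < 1 / 2)
    (by norm_num : (0 : ℝ) < 1 / 2) (by norm_num)
  exact absurd (hq.2 _ hm) (not_le.mpr hlt)

/-- The scalar `a_j(x)`. -/
noncomputable def aj (j : Fin D.s) (x : E d) : ℝ := (D.nearest j x).fst

/-- The vector `v_j(x)`. -/
noncomputable def vj (j : Fin D.s) (x : E d) : E d := (D.nearest j x).snd

end DCData

/-! ### The method of codifferential descent -/

/-- One iteration `x ↦ y` of the method of codifferential descent for `f`, with the hypodifferential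
`C` and the set `G` of hyperdifferential points at `x`, and the parameter `μ ∈ [0, +∞]`:
`p z = (a(z), v(z))` is the least norm element of `C + z`, `α z` is the step of the exact line search
from `x` along `-v(z)`, and `y` is the best of the points so obtained over all `z = (b, w) ∈ G`
with `b ≤ μ`. -/
def IsMCDStep {d : ℕ} (f : E d → ℝ) (C G : Set (EPlus d)) (μ : EReal) (x y : E d) : Prop :=
  ∃ (p : EPlus d → EPlus d) (α : EPlus d → ℝ),
    (∀ z ∈ G, (z.fst : EReal) ≤ μ → IsLeastNorm (translate C z) (p z)) ∧
    (∀ z ∈ G, (z.fst : EReal) ≤ μ → 0 ≤ α z ∧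
      ∀ β : ℝ, 0 ≤ β → f (x - α z • (p z).snd) ≤ f (x - β • (p z).snd)) ∧
    ∃ z₀ ∈ G, (z₀.fst : EReal) ≤ μ ∧
      (∀ z ∈ G, (z.fst : EReal) ≤ μ → f (x - α z₀ • (p z₀).snd) ≤ f (x - α z • (p z).snd)) ∧
      y = x - α z₀ • (p z₀).snd

/-- `x` is a sequence generated by the method of codifferential descent with `μ = +∞`, applied to
`f` with the hypodifferential `D.hypodiff` and the hyperdifferential points `z_j`. -/
def IsMCDSequence {d : ℕ} (f : E d → ℝ) (D : DCData d) (x : ℕ → E d) : Prop :=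
  ∀ n, IsMCDStep f (D.hypodiff (x n)) (range fun j => D.z j (x n)) ⊤ (x n) (x (n + 1))

/-- From some index on, `x n` passes the stopping test (`a_j(x n) ≥ 0` for all `j`) and is a global
minimizer of `f`. -/
def FindsGlobalMinimizer {d : ℕ} (f : E d → ℝ) (D : DCData d) (x : ℕ → E d) : Prop :=
  ∃ N : ℕ, ∀ n, N ≤ n → (∀ j, 0 ≤ D.aj j (x n)) ∧ ∀ y, f (x n) ≤ f y

end PiecewiseAffine

/-! A continuous selection of affine functions `g i` is a finite min of maxes: for each point `a`
take the max of those pieces lying below `f` at `a`. These maxes touch or stay below `f` at `a`, and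
stay above `f` everywhere by `exists_piece_le_ge`, a one-dimensional fact about segments. Min-max
expressions of affine functions are differences of maxima of affine functions, which gives the
representation.

Given a representation, `f` is the minimum of the convex pieces `g_j` (`DCData.piece`), and
`hypodiff x + z_j(x)` consists of affine minorants of `g_j - f x`. Let `(a, v)` be its least norm
element. If `a ≥ 0` then, as `g_j` is bounded below, `g_j ≥ f x` everywhere
(`le_piece_of_aj_nonneg`); if this holds for all `j`, then `x` is a global minimizer. If `a < 0`,
the step `v / a` brings `g_j` below `f x`, and either it lands on a minimizer of `g_j` or the
decrease is at least a constant independent of `x` (`exists_decrease`). For each `j` the first case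
can help only once and the second only finitely often, since `f` is bounded below. Existence of a
minimizer is a by-product. Codifferential descent is covered because its exact line search includes
the step `-1/a`. -/

/-! ### Piecewise affine functions as differences of maxima of affine functions -/

open Set in
/-- A continuous function on `[0, 1]` that is everywhere equal to one of finitely many affine
functions `p i + t * q i` has a piece lying below it at `0` and above it at `1`. -/
theorem exists_affine_piece_le_ge {ι : Type*} [Finite ι] {φ : ℝ → ℝ} (hφ : Continuous φ)
    (p q : ι → ℝ) (hsel : ∀ t, ∃ i, φ t = p i + t * q i) :
    ∃ i, p i ≤ φ 0 ∧ φ 1 ≤ p i + q i := by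
  by_contra! hcon
  set c : ℝ → ℝ := fun t => φ 0 + t * (φ 1 - φ 0) with hc
  have hcc : Continuous c := by fun_prop
  -- `c` is the chord of `φ`. For `t > 0` the last condition follows from `c t ≤ φ t`, because a
  -- piece starting at or below `φ 0` stays strictly below the chord; its role is to exclude `t = 0`
  -- while keeping `Z` closed.
  set Z : Set ℝ := Icc 0 1 ∩ {t | c t ≤ φ t} ∩ ⋃ i : {i // φ 0 < p i}, {t | φ t = p i + t * q i}
    with hZ
  have hZc : IsCompact Z := by
    refine (isCompact_Icc.inter_right (isClosed_le hcc hφ)).inter_right ?_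
    exact isClosed_iUnion_of_finite fun i => isClosed_eq hφ (by fun_prop)
  have h1 : (1 : ℝ) ∈ Z := by
    obtain ⟨i, hi⟩ := hsel 1
    refine ⟨⟨by simp, by simp [hc]⟩, mem_iUnion.2 ⟨⟨i, ?_⟩, hi⟩⟩
    by_contra! h
    linarith [hcon i h]
  obtain ⟨s, hs, hmin⟩ := hZc.exists_isLeast ⟨1, h1⟩
  have hs0 : 0 < s := by
    rcases hs.1.1.1.eq_or_lt with h | h
    · obtain ⟨⟨i, hi⟩, hsi⟩ := mem_iUnion.1 hs.2
      rw [← h] at hsi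
      simp only [mem_ofPred_eq, zero_mul, add_zero] at hsi
      linarith
    · exact h
  have hlt : ∀ t ∈ Ioo 0 s, φ t < c t := by
    intro t ht
    by_contra! h
    obtain ⟨i, hi⟩ := hsel t
    refine absurd (hmin (a := t) ⟨⟨⟨ht.1.le, ht.2.le.trans hs.1.1.2⟩, h⟩,
      mem_iUnion.2 ⟨⟨i, ?_⟩, hi⟩⟩) (not_le.2 ht.2)
    by_contra! h0
    have h2 := hcon i h0
    have h3 : t ≤ 1 := ht.2.le.trans hs.1.1.2
    simp only [hc] at h
    nlinarith [ht.1]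
  have hcl : s ∈ closure (Ioo 0 s) := by
    rw [closure_Ioo hs0.ne]
    exact ⟨hs0.le, le_rfl⟩
  have hsc : φ s = c s := by
    refine le_antisymm ?_ hs.1.2
    exact closure_minimal (fun t ht => (hlt t ht).le) (isClosed_le hφ hcc) hcl
  have hsub : Ioo 0 s ⊆ ⋃ i, {t | t ∈ Ioo 0 s ∧ φ t = p i + t * q i} := fun t ht => by
    obtain ⟨i, hi⟩ := hsel t
    exact mem_iUnion.2 ⟨i, ht, hi⟩
  -- By finiteness one piece is active both at `s` and at some `t < s`. It crosses the chord upwards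
  -- there, so it starts below `φ 0` and ends at or above `φ 1`, against `hcon`.
  have hcl' := closure_mono hsub hcl
  rw [closure_iUnion_of_finite, mem_iUnion] at hcl'
  obtain ⟨i, hi⟩ := hcl'
  have hsi : φ s = p i + s * q i :=
    closure_minimal (t := {t | φ t = p i + t * q i}) (fun t ht => ht.2)
      (isClosed_eq hφ (by fun_prop)) hi
  obtain ⟨t, ht, hti⟩ := closure_nonempty_iff.1 ⟨s, hi⟩
  have h1 := hlt t ht
  have h2 := hs.1.1.2
  simp only [hc] at h1 hsc
  have h3 : 0 < q i - (φ 1 - φ 0) := by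
    by_contra! h
    nlinarith [ht.2]
  have h4 : p i ≤ φ 0 := by nlinarith
  have h5 := hcon i h4
  nlinarith

namespace PiecewiseAffine

open Set

variable {d : ℕ}

/-- `P` is the maximum of a finite nonempty family of affine functions `x ↦ a + ⟨v, x⟩`. -/
def IsMaxAffine (P : E d → ℝ) : Prop :=
  ∃ s : Set (ℝ × E d), s.Finite ∧ ∀ x, IsGreatest ((fun p => p.1 + inner ℝ p.2 x) '' s) (P x)

/-- `f` is a difference of two maxima of finitely many affine functions. -/
def IsDCAffine (f : E d → ℝ) : Prop :=
  ∃ P Q : E d → ℝ, IsMaxAffine P ∧ IsMaxAffine Q ∧ ∀ x, f x = P x - Q x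

theorem isMaxAffine_affine (a : ℝ) (v : E d) : IsMaxAffine fun x => a + inner ℝ v x :=
  ⟨{(a, v)}, finite_singleton _, fun x => by simp⟩

theorem IsMaxAffine.add {P Q : E d → ℝ} (hP : IsMaxAffine P) (hQ : IsMaxAffine Q) :
    IsMaxAffine (P + Q) := by
  obtain ⟨s, hs, hPs⟩ := hP
  obtain ⟨t, ht, hQt⟩ := hQ
  refine ⟨(fun p : (ℝ × E d) × (ℝ × E d) => p.1 + p.2) '' s ×ˢ t, (hs.prod ht).image _,
    fun x => ⟨?_, ?_⟩⟩
  · obtain ⟨p, hp, hpx⟩ := (hPs x).1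
    obtain ⟨q, hq, hqx⟩ := (hQt x).1
    refine ⟨p + q, ⟨(p, q), ⟨hp, hq⟩, rfl⟩, ?_⟩
    simp only [Prod.fst_add, Prod.snd_add, inner_add_left, Pi.add_apply] at *
    linarith
  · rintro _ ⟨_, ⟨⟨p, q⟩, ⟨hp, hq⟩, rfl⟩, rfl⟩
    have h1 := (hPs x).2 ⟨p, hp, rfl⟩
    have h2 := (hQt x).2 ⟨q, hq, rfl⟩
    simp only [Prod.fst_add, Prod.snd_add, inner_add_left, Pi.add_apply] at *
    linarith

theorem IsMaxAffine.sup {P Q : E d → ℝ} (hP : IsMaxAffine P) (hQ : IsMaxAffine Q) :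
    IsMaxAffine (P ⊔ Q) := by
  obtain ⟨s, hs, hPs⟩ := hP
  obtain ⟨t, ht, hQt⟩ := hQ
  refine ⟨s ∪ t, hs.union ht, fun x => ?_⟩
  rw [image_union]
  exact (hPs x).union (hQt x)

theorem IsDCAffine.neg {f : E d → ℝ} (hf : IsDCAffine f) : IsDCAffine (-f) := by
  obtain ⟨P, Q, hP, hQ, h⟩ := hf
  exact ⟨Q, P, hQ, hP, fun x => by simp [h]⟩

/-- Bring both differences to the common subtrahend `Q + Q'`. -/
theorem IsDCAffine.sup {f g : E d → ℝ} (hf : IsDCAffine f) (hg : IsDCAffine g) :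
    IsDCAffine (f ⊔ g) := by
  obtain ⟨P, Q, hP, hQ, h⟩ := hf
  obtain ⟨P', Q', hP', hQ', h'⟩ := hg
  refine ⟨(P + Q') ⊔ (P' + Q), Q + Q', (hP.add hQ').sup (hP'.add hQ), hQ.add hQ', fun x => ?_⟩
  have e1 : f x = P x + Q' x - (Q x + Q' x) := by rw [h]; ring
  have e2 : g x = P' x + Q x - (Q x + Q' x) := by rw [h']; ring
  simp only [Pi.sup_apply, Pi.add_apply]
  rw [e1, e2, max_sub_sub_right]

theorem IsDCAffine.inf {f g : E d → ℝ} (hf : IsDCAffine f) (hg : IsDCAffine g) :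
    IsDCAffine (f ⊓ g) := by
  have h := (hf.neg.sup hg.neg).neg
  rwa [← neg_inf, neg_neg] at h

theorem isDCAffine_affineMap (g : E d →ᵃ[ℝ] ℝ) : IsDCAffine g := by
  refine ⟨g, fun _ => 0 + inner ℝ 0 _, ?_, isMaxAffine_affine 0 0, fun x => by simp⟩
  have e : (g : E d → ℝ) = fun x => g 0 + inner ℝ
      ((InnerProductSpace.toDual ℝ (E d)).symm (LinearMap.toContinuousLinearMap g.linear)) x := by
    funext x
    have h := congrFun g.decomp x
    simp only [InnerProductSpace.toDual_symm_apply, LinearMap.coe_toContinuousLinearMap']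
    simpa [add_comm] using h
  rw [e]
  exact isMaxAffine_affine _ _

/-- A continuous selection of finitely many affine functions has, for any two points, a piece that
lies below it at the first point and above it at the second one. -/
theorem exists_piece_le_ge {ι : Type*} [Finite ι] {f : E d → ℝ} (hf : Continuous f)
    (g : ι → E d →ᵃ[ℝ] ℝ) (hsel : ∀ x, ∃ i, f x = g i x) (a b : E d) :
    ∃ i, g i a ≤ f a ∧ f b ≤ g i b := by
  have key : ∀ i t, g i (AffineMap.lineMap a b t) = g i a + t * (g i b - g i a) := by
    intro i t
    rw [AffineMap.apply_lineMap, AffineMap.lineMap_apply]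
    simp [add_comm]
  obtain ⟨i, h0, h1⟩ := exists_affine_piece_le_ge (φ := fun t => f (AffineMap.lineMap a b t))
    (hf.comp AffineMap.lineMap_continuous) (fun i => g i a) (fun i => g i b - g i a) (fun t => by
      obtain ⟨i, hi⟩ := hsel (AffineMap.lineMap a b t)
      exact ⟨i, by rw [hi, key]⟩)
  exact ⟨i, by simpa using h0, by simpa using h1⟩

/-- A continuous selection of finitely many affine functions is a minimum of maxima of them, hence
a difference of maxima of affine functions. -/
theorem isDCAffine_of_selection {ι : Type*} [Fintype ι] {f : E d → ℝ} (hf : Continuous f)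
    (g : ι → E d →ᵃ[ℝ] ℝ) (hsel : ∀ x, ∃ i, f x = g i x) : IsDCAffine f := by
  classical
  let S : E d → Finset ι := fun a => Finset.univ.filter fun i => g i a ≤ f a
  have hS : ∀ a, (S a).Nonempty := fun a => by
    obtain ⟨i, hi⟩ := hsel a
    exact ⟨i, by simp [S, hi]⟩
  -- Indexing by the sets `S a` rather than by the points `a` makes the minimum finite.
  let T := {s : Finset ι // ∃ a, s = S a}
  have hT : ∀ s : T, s.1.Nonempty := fun s => by
    obtain ⟨a, ha⟩ := s.2
    exact ha ▸ hS a
  let F : T → E d → ℝ := fun s => s.1.sup' (hT s) fun i => (g i : E d → ℝ)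
  have hne : (Finset.univ : Finset T).Nonempty := ⟨⟨S 0, 0, rfl⟩, Finset.mem_univ _⟩
  have e : f = Finset.univ.inf' hne F := by
    funext x
    rw [Finset.inf'_apply]
    refine le_antisymm (Finset.le_inf' _ _ ?_) ?_
    · rintro ⟨_, a, rfl⟩ -
      obtain ⟨i, hia, hix⟩ := exists_piece_le_ge hf g hsel a x
      simp only [F, Finset.sup'_apply]
      exact hix.trans (Finset.le_sup' (fun i => g i x) (by simpa [S] using hia))
    · refine (Finset.inf'_le (fun s => F s x) (Finset.mem_univ ⟨S x, x, rfl⟩)).trans ?_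
      simp only [F, Finset.sup'_apply]
      refine Finset.sup'_le _ _ fun i hi => ?_
      simpa [S] using hi
  rw [e]
  refine Finset.inf'_induction hne F (fun _ h _ h' => h.inf h') fun s _ => ?_
  exact Finset.sup'_induction (hT s) _ (fun _ h _ h' => h.sup h') fun i _ =>
    isDCAffine_affineMap (g i)

theorem IsPolyhedral.isClosed {Q : Set (E d)} (hQ : IsPolyhedral Q) : IsClosed Q := by
  obtain ⟨m, u, c, -, rfl⟩ := hQ
  simp only [ofPred_forall]
  exact isClosed_iInter fun i => isClosed_le (by fun_prop) continuous_const

theorem IsPiecewiseAffine.isDCAffine {f : E d → ℝ} (hf : IsPiecewiseAffine f) : IsDCAffine f := by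
  obtain ⟨k, Q, hQ, hfg⟩ := hf
  choose g hg using hfg
  refine isDCAffine_of_selection ?_ g fun x => ?_
  · refine (locallyFinite_of_finite Q).continuous hQ.cover (fun i => (hQ.polyhedral i).isClosed)
      fun i => ((g i).continuous_of_finiteDimensional.continuousOn).congr (hg i)
  · obtain ⟨i, hi⟩ := mem_iUnion.1 (hQ.cover ▸ mem_univ x : x ∈ ⋃ i, Q i)
    exact ⟨i, hg i hi⟩

theorem IsMaxAffine.exists_family {P : E d → ℝ} (hP : IsMaxAffine P) :
    ∃ (n : ℕ) (_ : 0 < n) (a : Fin n → ℝ) (v : Fin n → E d),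
      ∀ x, IsGreatest (range fun i => a i + inner ℝ (v i) x) (P x) := by
  obtain ⟨s, hs, h⟩ := hP
  have := hs.to_subtype
  obtain ⟨n, ⟨e⟩⟩ := Finite.exists_equiv_fin s
  refine ⟨n, ?_, fun i => (e.symm i).1.1, fun i => (e.symm i).1.2, fun x => ?_⟩
  · obtain ⟨p, hp, -⟩ := (h 0).1
    exact (e ⟨p, hp⟩).pos
  · convert h x using 1
    ext r
    constructor
    · rintro ⟨i, rfl⟩
      exact ⟨_, (e.symm i).2, rfl⟩
    · rintro ⟨p, hp, rfl⟩
      exact ⟨e ⟨p, hp⟩, by simp⟩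

theorem IsDCAffine.exists_represents {f : E d → ℝ} (hf : IsDCAffine f) :
    ∃ D : DCData d, D.Represents f := by
  obtain ⟨P, Q, hP, hQ, h⟩ := hf
  obtain ⟨l, hl, a, v, hP⟩ := hP.exists_family
  obtain ⟨s, hs, b, w, hQ⟩ := hQ.exists_family
  refine ⟨⟨l, s, hl, hs, a, v, fun j => - b j, fun j => - w j⟩, fun x => ?_⟩
  rw [h, sub_eq_add_neg]
  congr 1
  · refine le_antisymm ?_ (Finset.sup'_le _ _ fun i _ => (hP x).2 ⟨i, rfl⟩)
    obtain ⟨i, hi⟩ := (hP x).1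
    rw [← hi]
    exact Finset.le_sup' (fun i => a i + inner ℝ (v i) x) (Finset.mem_univ i)
  · refine le_antisymm (Finset.le_inf' _ _ fun j _ => ?_) ?_
    · have := (hQ x).2 ⟨j, rfl⟩
      simp only [inner_neg_left]
      linarith
    · obtain ⟨j, hj⟩ := (hQ x).1
      rw [← hj]
      refine (Finset.inf'_le _ (Finset.mem_univ j)).trans ?_
      simp only [inner_neg_left]
      linarith

end PiecewiseAffine

/-! ### Least norm elements and the convex pieces -/

namespace PiecewiseAffine

open Set

/-- If `p` minimizes `⟨p, ·⟩` over `K` and lies in its convex hull, then `p` lies in the convex hull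
of the points of `K` at which the minimum is attained. -/
theorem mem_convexHull_active {F : Type*} [NormedAddCommGroup F] [InnerProductSpace ℝ F]
    {K : Set F} {p : F} (hp : p ∈ convexHull ℝ K) (hK : ∀ q ∈ K, ‖p‖ ^ 2 ≤ inner ℝ p q) :
    p ∈ convexHull ℝ {q ∈ K | inner ℝ p q = ‖p‖ ^ 2} := by
  classical
  obtain ⟨ι, _, w, z, hw, hw1, hz, hsum⟩ := mem_convexHull_iff_exists_fintype.1 hp
  have h0 : ∑ i, w i * (inner ℝ p (z i) - ‖p‖ ^ 2) = 0 := by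
    have : inner ℝ p (∑ i, w i • z i) = ‖p‖ ^ 2 := by
      rw [hsum, real_inner_self_eq_norm_sq]
    simp only [inner_sum, inner_smul_right] at this
    simp only [mul_sub, Finset.sum_sub_distrib, ← Finset.sum_mul, hw1, this]
    ring
  have hz0 := (Finset.sum_eq_zero_iff_of_nonneg fun i _ =>
    mul_nonneg (hw i) (sub_nonneg.2 (hK _ (hz i)))).1 h0
  have hs : ∑ i with w i ≠ 0, w i • z i = p := by
    rw [← hsum]
    exact Finset.sum_filter_of_ne fun i _ h hi => h (by simp [hi])
  have hmem : ∑ i with w i ≠ 0, w i • z i ∈ convexHull ℝ {q ∈ K | inner ℝ p q = ‖p‖ ^ 2} := by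
    refine (convex_convexHull ℝ _).sum_mem (fun i _ => hw i) ?_ fun i hi => ?_
    · rw [← hw1]
      exact Finset.sum_filter_ne_zero _
    · refine subset_convexHull ℝ _ ⟨hz i, ?_⟩
      have h1 := (mul_eq_zero.1 (hz0 i (Finset.mem_univ i))).resolve_left (Finset.mem_filter.1 hi).2
      linarith
  rwa [hs] at hmem

/-- An element of least norm of a convex set. -/
theorem norm_sq_le_inner_of_le_norm {F : Type*} [NormedAddCommGroup F] [InnerProductSpace ℝ F]
    {C : Set F} (hC : Convex ℝ C) {p : F} (hp : p ∈ C) (hmin : ∀ q ∈ C, ‖p‖ ≤ ‖q‖) {q : F}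
    (hq : q ∈ C) : ‖p‖ ^ 2 ≤ inner ℝ p q := by
  have := (⟨⟨p, hp⟩⟩ : Nonempty C)
  have h := (norm_eq_iInf_iff_real_inner_le_zero hC (u := 0) hp).1 (by
    refine le_antisymm (le_ciInf fun q => by simpa using hmin q q.2) ?_
    exact ciInf_le (f := fun w : C => ‖(0 : F) - w‖) ⟨0, by rintro _ ⟨q, rfl⟩; positivity⟩ ⟨p, hp⟩)
    q hq
  rw [zero_sub, inner_neg_left, inner_sub_right, real_inner_self_eq_norm_sq] at h
  linarith

/-- The norms of the elements of the convex hulls, not containing the origin, of subfamilies of a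
finite family are bounded away from zero. -/
theorem exists_pos_le_norm_of_subfamily {F : Type*} [NormedAddCommGroup F] [NormedSpace ℝ F]
    {ι : Type*} [Finite ι] (u : ι → F) :
    ∃ c : ℝ, 0 < c ∧ ∀ S : Set ι, (0 : F) ∉ convexHull ℝ (u '' S) →
      ∀ v ∈ convexHull ℝ (u '' S), c ≤ ‖v‖ := by
  have h : ∀ S : Set ι, ∃ c : ℝ, 0 < c ∧ ((0 : F) ∉ convexHull ℝ (u '' S) →
      ∀ v ∈ convexHull ℝ (u '' S), c ≤ ‖v‖) := by
    intro S
    by_cases h0 : (0 : F) ∈ convexHull ℝ (u '' S)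
    · exact ⟨1, one_pos, fun h => absurd h0 h⟩
    · have hcl : IsClosed (convexHull ℝ (u '' S)) :=
        ((S.toFinite.image u).isCompact_convexHull (𝕜 := ℝ)).isClosed
      obtain ⟨c, hc, hball⟩ := Metric.mem_nhds_iff.1 (hcl.isOpen_compl.mem_nhds h0)
      refine ⟨c, hc, fun _ v hv => ?_⟩
      by_contra! hlt
      exact hball (by simpa using hlt) hv
  choose c hc hcS using h
  obtain ⟨S, hS⟩ := Finite.exists_min c
  exact ⟨c S, hc S, fun T h0 v hv => (hS T).trans (hcS T h0 v hv)⟩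

namespace DCData

variable {d : ℕ} (D : DCData d)

/-- The convex piece `g_j = max_i (a_i + ⟨v_i, ·⟩) + b_j + ⟨w_j, ·⟩`. -/
noncomputable def piece (j : Fin D.s) (x : E d) : ℝ :=
  D.convexPart x + (D.b j + inner ℝ (D.w j) x)

theorem piece_le_iff {j : Fin D.s} {x : E d} {r : ℝ} :
    D.piece j x ≤ r ↔
      ∀ i, D.a i + inner ℝ (D.v i) x + (D.b j + inner ℝ (D.w j) x) ≤ r := by
  rw [piece, ← le_sub_iff_add_le, convexPart, Finset.sup'_le_iff]
  simp only [Finset.mem_univ, true_imp_iff, le_sub_iff_add_le]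

theorem le_piece (j : Fin D.s) (i : Fin D.l) (x : E d) :
    D.a i + inner ℝ (D.v i) x + (D.b j + inner ℝ (D.w j) x) ≤ D.piece j x :=
  D.piece_le_iff.1 le_rfl i

variable {D} {f : E d → ℝ}

theorem Represents.le_piece (hD : D.Represents f) (j : Fin D.s) (x : E d) : f x ≤ D.piece j x := by
  rw [hD, piece]
  gcongr
  exact Finset.inf'_le (fun j => D.b j + inner ℝ (D.w j) x) (Finset.mem_univ j)

theorem Represents.exists_eq_piece (hD : D.Represents f) (x : E d) : ∃ j, f x = D.piece j x := by
  obtain ⟨j, -, hj⟩ := Finset.exists_mem_eq_inf' D.univ_nonempty_J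
    fun j => D.b j + inner ℝ (D.w j) x
  exact ⟨j, by rw [hD, piece, ← hj, concavePart]⟩

/-- The two normalizing terms, the convex and the concave part at `x`, add up to `f x`. -/
theorem Represents.translate_eq (hD : D.Represents f) (j : Fin D.s) (x : E d) :
    translate (D.hypodiff x) (D.z j x) = convexHull ℝ (range fun i =>
      pair (D.a i + inner ℝ (D.v i) x + (D.b j + inner ℝ (D.w j) x) - f x) (D.v i + D.w j)) := by
  have e : (fun p => p + D.z j x) =
      (AffineMap.id ℝ (EPlus d) + AffineMap.const ℝ (EPlus d) (D.z j x) : EPlus d →ᵃ[ℝ] EPlus d) :=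
    rfl
  rw [translate, hypodiff, e, AffineMap.image_convexHull, ← e, ← range_comp]
  congr 2
  funext i
  simp only [Function.comp_apply, z, pair, ← WithLp.toLp_add, Prod.mk_add_mk]
  congr 2
  rw [hD]
  ring

theorem pair_fst (a : ℝ) (v : E d) : (pair a v).fst = a := rfl

theorem pair_snd (a : ℝ) (v : E d) : (pair a v).snd = v := rfl

theorem inner_eq (p q : EPlus d) : inner ℝ p q = p.fst * q.fst + inner ℝ p.snd q.snd := by
  rw [WithLp.prod_inner_apply]
  simp [mul_comm]

theorem norm_sq_eq (p : EPlus d) : ‖p‖ ^ 2 = p.fst ^ 2 + ‖p.snd‖ ^ 2 := by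
  rw [← real_inner_self_eq_norm_sq, inner_eq, real_inner_self_eq_norm_sq]
  ring

/-- Every element of `hypodiff x + z_j(x)` gives an affine minorant of `g_j - f x`. -/
theorem Represents.fst_add_inner_le (hD : D.Represents f) {j : Fin D.s} {x : E d} {q : EPlus d}
    (hq : q ∈ translate (D.hypodiff x) (D.z j x)) (y : E d) :
    q.fst + inner ℝ q.snd (y - x) ≤ D.piece j y - f x := by
  rw [hD.translate_eq] at hq
  refine convexHull_min (t := {q | q.fst + inner ℝ q.snd (y - x) ≤ D.piece j y - f x}) ?_ ?_ hq
  · rintro _ ⟨i, rfl⟩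
    have := D.le_piece j i y
    simp only [mem_ofPred_eq, pair_fst, pair_snd, inner_add_left, inner_sub_right]
    linarith
  · intro p hp q hq s t hs ht hst
    simp only [mem_ofPred_eq, WithLp.add_fst, WithLp.add_snd, WithLp.smul_fst, WithLp.smul_snd,
      inner_add_left, inner_smul_left, smul_eq_mul] at *
    have h1 := mul_le_mul_of_nonneg_left hp hs
    have h2 := mul_le_mul_of_nonneg_left hq ht
    simp only [RCLike.conj_to_real]
    have h3 : D.piece j y - f x = s * (D.piece j y - f x) + t * (D.piece j y - f x) := by
      rw [← add_mul, hst, one_mul]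
    linarith

theorem norm_sq_le_inner_nearest {j : Fin D.s} {x : E d} {q : EPlus d}
    (hD : D.Represents f) (hq : q ∈ translate (D.hypodiff x) (D.z j x)) :
    D.aj j x ^ 2 + ‖D.vj j x‖ ^ 2 ≤ D.aj j x * q.fst + inner ℝ (D.vj j x) q.snd := by
  have h := D.nearest_isLeastNorm j x
  have hc : Convex ℝ (translate (D.hypodiff x) (D.z j x)) := by
    rw [hD.translate_eq]
    exact convex_convexHull ℝ _
  have := norm_sq_le_inner_of_le_norm hc h.1 h.2 hq
  rwa [norm_sq_eq, inner_eq] at this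

/-- If `a_j(x) < 0`, then the point `x + a_j(x)⁻¹ v_j(x)` decreases the value of `f`. -/
theorem Represents.piece_step_le (hD : D.Represents f) {j : Fin D.s} {x : E d}
    (hneg : D.aj j x < 0) :
    D.piece j (x + (D.aj j x)⁻¹ • D.vj j x) ≤
      f x + (D.aj j x + ‖D.vj j x‖ ^ 2 / D.aj j x) := by
  rw [D.piece_le_iff]
  intro i
  have hq : pair (D.a i + inner ℝ (D.v i) x + (D.b j + inner ℝ (D.w j) x) - f x) (D.v i + D.w j) ∈
      translate (D.hypodiff x) (D.z j x) := by
    rw [hD.translate_eq]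
    exact subset_convexHull ℝ _ ⟨i, rfl⟩
  have h := norm_sq_le_inner_nearest hD hq
  simp only [pair_fst, pair_snd, inner_add_right, inner_smul_right] at h ⊢
  rw [real_inner_comm (D.v i), real_inner_comm (D.w j)] at h
  set A := D.aj j x
  -- Dividing the projection inequality by `A < 0` reverses it into an upper bound for each affine
  -- function at the new point.
  have h' : A⁻¹ * (A * (D.a i + inner ℝ (D.v i) x + (D.b j + inner ℝ (D.w j) x) - f x) +
      (inner ℝ (D.v i) (D.vj j x) + inner ℝ (D.w j) (D.vj j x))) ≤
      A⁻¹ * (A ^ 2 + ‖D.vj j x‖ ^ 2) :=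
    mul_le_mul_of_nonpos_left h (inv_nonpos.2 hneg.le)
  have e : A⁻¹ * A = 1 := inv_mul_cancel₀ hneg.ne
  have e1 : A⁻¹ * (A ^ 2 + ‖D.vj j x‖ ^ 2) = A + ‖D.vj j x‖ ^ 2 / A := by
    field_simp
  rw [e1, mul_add, ← mul_assoc, e] at h'
  linarith

/-- A point with `a_j(x) < 0` is moved to a minimizer of the piece `g_j`, or the value of `f`
decreases by a uniform amount. -/
theorem Represents.exists_decrease (hD : D.Represents f) (j : Fin D.s) :
    ∃ c : ℝ, 0 < c ∧ ∀ x, D.aj j x < 0 →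
      D.piece j (x + (D.aj j x)⁻¹ • D.vj j x) < f x ∧
      ((∀ y, D.piece j (x + (D.aj j x)⁻¹ • D.vj j x) ≤ D.piece j y) ∨
        D.piece j (x + (D.aj j x)⁻¹ • D.vj j x) ≤ f x - c) := by
  -- The slopes do not depend on `x`, so `c` serves all `x` whatever the set of active indices.
  obtain ⟨c, hc, hcS⟩ := exists_pos_le_norm_of_subfamily fun i => D.v i + D.w j
  refine ⟨c, hc, fun x hneg => ?_⟩
  have hstep := hD.piece_step_le hneg
  have hdiv : ‖D.vj j x‖ ^ 2 / D.aj j x ≤ 0 := div_nonpos_of_nonneg_of_nonpos (by positivity) hneg.le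
  refine ⟨by linarith, ?_⟩
  have hleast := D.nearest_isLeastNorm j x
  set P : Fin D.l → EPlus d := fun i =>
    pair (D.a i + inner ℝ (D.v i) x + (D.b j + inner ℝ (D.w j) x) - f x) (D.v i + D.w j) with hP
  have hC : translate (D.hypodiff x) (D.z j x) = convexHull ℝ (range P) := hD.translate_eq j x
  rw [hC] at hleast
  have hact := mem_convexHull_active hleast.1 fun q hq =>
    norm_sq_le_inner_of_le_norm (convex_convexHull ℝ _) hleast.1 hleast.2
      (subset_convexHull ℝ _ hq)
  set p := D.nearest j x with hp
  set S : Set (Fin D.l) := {i | inner ℝ p (P i) = ‖p‖ ^ 2} with hS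
  have hK : {q ∈ range P | inner ℝ p q = ‖p‖ ^ 2} = P '' S := by
    ext q
    constructor
    · rintro ⟨⟨i, rfl⟩, hi⟩
      exact ⟨i, hi, rfl⟩
    · rintro ⟨i, hi, rfl⟩
      exact ⟨⟨i, rfl⟩, hi⟩
  rw [hK] at hact
  have himg : (fun i => D.v i + D.w j) '' S = WithLp.sndₗ 2 ℝ ℝ (E d) '' (P '' S) := by
    rw [image_image]
    rfl
  have hhull : convexHull ℝ ((fun i => D.v i + D.w j) '' S) =
      WithLp.sndₗ 2 ℝ ℝ (E d) '' convexHull ℝ (P '' S) := by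
    rw [himg, LinearMap.image_convexHull]
  -- If zero is a convex combination of active slopes, the face contains some `(q, 0)` with `a * q =
  -- ‖p‖ ^ 2`: a constant minorant of `g_j - f x` at exactly the level bounding the step. Otherwise
  -- `‖v‖ ≥ c`, and the decrease `|a| + ‖v‖ ^ 2 / |a|` is at least `2 * ‖v‖`.
  by_cases h0 : (0 : E d) ∈ convexHull ℝ ((fun i => D.v i + D.w j) '' S)
  · left
    rw [hhull] at h0
    obtain ⟨q, hq, hq0⟩ := h0
    have hq0 : q.snd = 0 := hq0
    have hqC : q ∈ translate (D.hypodiff x) (D.z j x) := by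
      rw [hC]
      exact convexHull_mono (image_subset_range _ _) hq
    have hqle : inner ℝ p q ≤ ‖p‖ ^ 2 := by
      refine convexHull_min (t := {q | inner ℝ p q ≤ ‖p‖ ^ 2}) ?_ ?_ hq
      · rintro _ ⟨i, hi, rfl⟩
        exact le_of_eq hi
      · exact convex_halfSpace_le (innerSL ℝ p).toLinearMap.isLinear _
    rw [inner_eq, norm_sq_eq, hq0, inner_zero_right, add_zero] at hqle
    change D.aj j x * q.fst ≤ D.aj j x ^ 2 + ‖D.vj j x‖ ^ 2 at hqle
    have hfst : D.aj j x + ‖D.vj j x‖ ^ 2 / D.aj j x ≤ q.fst := by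
      have e : D.aj j x + ‖D.vj j x‖ ^ 2 / D.aj j x =
          (D.aj j x ^ 2 + ‖D.vj j x‖ ^ 2) / D.aj j x := by
        field_simp [hneg.ne]
      rw [e, div_le_iff_of_neg hneg]
      linarith
    intro y
    have := hD.fst_add_inner_le hqC y
    rw [hq0, inner_zero_left] at this
    linarith
  · right
    have hv : c ≤ ‖D.vj j x‖ := by
      refine hcS S h0 _ ?_
      rw [hhull]
      exact ⟨p, hact, rfl⟩
    have : ‖D.vj j x‖ ^ 2 / D.aj j x ≤ - D.aj j x - 2 * ‖D.vj j x‖ := by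
      rw [div_le_iff_of_neg hneg]
      nlinarith [sq_nonneg (D.aj j x + ‖D.vj j x‖)]
    linarith

/-- Boundedness below forces the origin into the convex hull of the slopes. -/
theorem zero_mem_convexHull_slopes {j : Fin D.s} (hb : BddBelow (range (D.piece j))) :
    (0 : E d) ∈ convexHull ℝ (range fun i => D.v i + D.w j) := by
  by_contra h0
  obtain ⟨φ, r, hr, hφ⟩ := geometric_hahn_banach_point_closed (convex_convexHull ℝ _)
    ((finite_range _).isCompact_convexHull (𝕜 := ℝ)).isClosed h0
  rw [map_zero] at hr
  obtain ⟨m, hm⟩ := hb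
  set u := (InnerProductSpace.toDual ℝ (E d)).symm φ
  have : Nonempty (Fin D.l) := ⟨⟨0, D.l_pos⟩⟩
  obtain ⟨i₀, hi₀⟩ := Finite.exists_max fun i => D.a i + D.b j
  set M := D.a i₀ + D.b j
  -- Far enough along `-u`, on which every slope decreases at rate at least `r`, to fall below the
  -- lower bound `m`.
  set t : ℝ := max 0 ((M - m + 1) / r)
  have ht : 0 ≤ t := le_max_left _ _
  have htr : M - m + 1 ≤ t * r := (div_le_iff₀ hr).1 (le_max_right _ _)
  have h1 : D.piece j (-(t • u)) ≤ M - t * r := by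
    rw [D.piece_le_iff]
    intro i
    have h2 := hφ _ (subset_convexHull ℝ _ ⟨i, rfl⟩)
    have h3 : φ (D.v i + D.w j) = inner ℝ (D.v i) u + inner ℝ (D.w j) u := by
      rw [← inner_add_left, real_inner_comm]
      exact (InnerProductSpace.toDual_symm_apply).symm
    rw [h3] at h2
    have h4 := mul_le_mul_of_nonneg_left h2.le ht
    have h5 := hi₀ i
    simp only [inner_neg_right, inner_smul_right]
    linarith
  have h2 := hm ⟨-(t • u), rfl⟩
  linarith

/-- If `a_j(x) ≥ 0`, then `g_j` is nowhere less than `f x`. -/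
theorem Represents.le_piece_of_aj_nonneg (hD : D.Represents f) {j : Fin D.s}
    (hb : BddBelow (range (D.piece j))) {x : E d} (hx : 0 ≤ D.aj j x) (y : E d) :
    f x ≤ D.piece j y := by
  have h0 := zero_mem_convexHull_slopes hb
  have himg : (range fun i => D.v i + D.w j) = WithLp.sndₗ 2 ℝ ℝ (E d) '' range fun i =>
      pair (D.a i + inner ℝ (D.v i) x + (D.b j + inner ℝ (D.w j) x) - f x) (D.v i + D.w j) := by
    rw [← range_comp]
    rfl
  rw [himg, ← LinearMap.image_convexHull, ← hD.translate_eq] at h0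
  obtain ⟨q, hq, hq0⟩ := h0
  have hq0 : q.snd = 0 := hq0
  by_contra! hlt
  have h1 := hD.fst_add_inner_le hq y
  have h2 := norm_sq_le_inner_nearest hD hq
  rw [hq0, inner_zero_left] at h1
  rw [hq0, inner_zero_right] at h2
  -- The constant minorant `q` is negative, so the projection inequality forces the least norm
  -- element to vanish; then zero itself is a minorant of `g_j - f x`.
  have h3 : D.aj j x * q.fst ≤ 0 := mul_nonpos_of_nonneg_of_nonpos hx (by linarith)
  have ha : D.aj j x = 0 := by
    by_contra h
    have := pow_pos (lt_of_le_of_ne hx (Ne.symm h)) 2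
    nlinarith [sq_nonneg ‖D.vj j x‖]
  have hv : D.vj j x = 0 := by
    rw [ha] at h2
    have : ‖D.vj j x‖ ^ 2 ≤ 0 := by linarith
    simpa using this
  have h4 := hD.fst_add_inner_le (D.nearest_isLeastNorm j x).1 y
  change D.aj j x + inner ℝ (D.vj j x) (y - x) ≤ _ at h4
  rw [ha, hv, inner_zero_left] at h4
  linarith

end DCData

end PiecewiseAffine

/-! ### Line search, finite convergence and codifferential descent -/

open Filter Topology in
/-- A continuous function that is affine near `+∞` and bounded below attains its minimum over
`[0, +∞)`. -/
theorem exists_forall_le_of_eventually_affine {φ : ℝ → ℝ} (hφ : Continuous φ)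
    (haff : ∃ p q : ℝ, ∀ᶠ t in atTop, φ t = p + q * t) (hb : BddBelow (Set.range φ)) :
    ∃ t, 0 ≤ t ∧ ∀ s, 0 ≤ s → φ t ≤ φ s := by
  obtain ⟨p, q, h⟩ := haff
  obtain ⟨T₀, hT₀⟩ := eventually_atTop.1 h
  obtain ⟨m, hm⟩ := hb
  have hq : 0 ≤ q := by
    by_contra! hq
    have h1 : Tendsto (fun t : ℝ => p + q * t) atTop atBot :=
      tendsto_atBot_add_const_left _ _ (tendsto_id.const_mul_atTop_of_neg hq)
    obtain ⟨t, ht, ht'⟩ := (h.and (h1.eventually_lt_atBot m)).exists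
    have := hm ⟨t, rfl⟩
    linarith
  set T := max T₀ 0
  have hT : 0 ≤ T := le_max_right _ _
  obtain ⟨t, ht, hmin⟩ := isCompact_Icc.exists_isMinOn (Set.nonempty_Icc.2 hT) hφ.continuousOn
  refine ⟨t, ht.1, fun s hs => ?_⟩
  rcases le_total s T with hsT | hsT
  · exact hmin ⟨hs, hsT⟩
  · refine (hmin ⟨hT, le_rfl⟩ : φ t ≤ φ T).trans ?_
    rw [hT₀ T (le_max_left _ _), hT₀ s ((le_max_left _ _).trans hsT)]
    gcongr

namespace PiecewiseAffine

open Set Filter Topology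

/-- `φ` coincides with an affine function near `+∞`. -/
def EventuallyAffine (φ : ℝ → ℝ) : Prop :=
  ∃ p q : ℝ, ∀ᶠ t in atTop, φ t = p + q * t

theorem eventually_affine_le_or_ge (p q p' q' : ℝ) :
    (∀ᶠ t : ℝ in atTop, p + q * t ≤ p' + q' * t) ∨
      ∀ᶠ t : ℝ in atTop, p' + q' * t ≤ p + q * t := by
  have key : ∀ p q p' q' : ℝ, q < q' → ∀ᶠ t : ℝ in atTop, p + q * t ≤ p' + q' * t := by
    intro p q p' q' h
    filter_upwards [eventually_ge_atTop ((p - p') / (q' - q))] with t ht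
    rw [div_le_iff₀ (sub_pos.2 h)] at ht
    linarith
  rcases lt_trichotomy q q' with h | rfl | h
  · exact Or.inl (key _ _ _ _ h)
  · rcases le_total p p' with h | h
    · exact Or.inl (Eventually.of_forall fun t => by gcongr)
    · exact Or.inr (Eventually.of_forall fun t => by gcongr)
  · exact Or.inr (key _ _ _ _ h)

theorem EventuallyAffine.sup {φ ψ : ℝ → ℝ} (hφ : EventuallyAffine φ) (hψ : EventuallyAffine ψ) :
    EventuallyAffine (φ ⊔ ψ) := by
  obtain ⟨p, q, h⟩ := hφ
  obtain ⟨p', q', h'⟩ := hψ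
  rcases eventually_affine_le_or_ge p q p' q' with hle | hle
  · refine ⟨p', q', ?_⟩
    filter_upwards [h, h', hle] with t h1 h2 h3
    rw [Pi.sup_apply, h1, h2, sup_of_le_right h3]
  · refine ⟨p, q, ?_⟩
    filter_upwards [h, h', hle] with t h1 h2 h3
    rw [Pi.sup_apply, h1, h2, sup_of_le_left h3]

theorem EventuallyAffine.inf {φ ψ : ℝ → ℝ} (hφ : EventuallyAffine φ) (hψ : EventuallyAffine ψ) :
    EventuallyAffine (φ ⊓ ψ) := by
  obtain ⟨p, q, h⟩ := hφ
  obtain ⟨p', q', h'⟩ := hψ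
  rcases eventually_affine_le_or_ge p q p' q' with hle | hle
  · refine ⟨p, q, ?_⟩
    filter_upwards [h, h', hle] with t h1 h2 h3
    rw [Pi.inf_apply, h1, h2, inf_of_le_left h3]
  · refine ⟨p', q', ?_⟩
    filter_upwards [h, h', hle] with t h1 h2 h3
    rw [Pi.inf_apply, h1, h2, inf_of_le_right h3]

theorem EventuallyAffine.add {φ ψ : ℝ → ℝ} (hφ : EventuallyAffine φ) (hψ : EventuallyAffine ψ) :
    EventuallyAffine (φ + ψ) := by
  obtain ⟨p, q, h⟩ := hφ
  obtain ⟨p', q', h'⟩ := hψ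
  refine ⟨p + p', q + q', ?_⟩
  filter_upwards [h, h'] with t h1 h2
  rw [Pi.add_apply, h1, h2]
  ring

variable {d : ℕ}

theorem eventuallyAffine_ray (c : ℝ) (u x v : E d) :
    EventuallyAffine fun t : ℝ => c + inner ℝ u (x - t • v) :=
  ⟨c + inner ℝ u x, - inner ℝ u v, Eventually.of_forall fun t => by
    simp only [inner_sub_right, inner_smul_right]
    ring⟩

namespace DCData

variable {D : DCData d} {f : E d → ℝ}

theorem Represents.continuous (hD : D.Represents f) : Continuous f := by
  rw [show f = fun x => D.convexPart x + D.concavePart x from funext hD]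
  unfold convexPart concavePart
  refine Continuous.add ?_ ?_
  · exact Continuous.finset_sup'_apply _ fun i _ => by fun_prop
  · exact Continuous.finset_inf'_apply _ fun i _ => by fun_prop

theorem Represents.eventuallyAffine (hD : D.Represents f) (x v : E d) :
    EventuallyAffine fun t : ℝ => f (x - t • v) := by
  have e : (fun t : ℝ => f (x - t • v)) =
      Finset.univ.sup' D.univ_nonempty_I
          (fun i (t : ℝ) => D.a i + inner ℝ (D.v i) (x - t • v)) +
        Finset.univ.inf' D.univ_nonempty_J
          (fun j (t : ℝ) => D.b j + inner ℝ (D.w j) (x - t • v)) := by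
    funext t
    rw [hD, Pi.add_apply, Finset.sup'_apply, Finset.inf'_apply]
    rfl
  rw [e]
  refine EventuallyAffine.add ?_ ?_
  · exact Finset.sup'_induction _ _ (fun _ h _ h' => h.sup h') fun i _ =>
      eventuallyAffine_ray _ _ _ _
  · exact Finset.inf'_induction _ _ (fun _ h _ h' => h.inf h') fun i _ =>
      eventuallyAffine_ray _ _ _ _

/-- The exact line search is well defined. -/
theorem Represents.exists_line_search (hD : D.Represents f) (hb : BddBelow (range f)) (x v : E d) :
    ∃ t : ℝ, 0 ≤ t ∧ ∀ s : ℝ, 0 ≤ s → f (x - t • v) ≤ f (x - s • v) := by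
  refine exists_forall_le_of_eventually_affine (φ := fun t : ℝ => f (x - t • v))
    (hD.continuous.comp (by fun_prop)) (hD.eventuallyAffine x v) (hb.mono ?_)
  rintro _ ⟨t, rfl⟩
  exact ⟨_, rfl⟩

theorem Represents.bddBelow_piece (hD : D.Represents f) (hb : BddBelow (range f)) (j : Fin D.s) :
    BddBelow (range (D.piece j)) := by
  obtain ⟨m, hm⟩ := hb
  refine ⟨m, ?_⟩
  rintro _ ⟨x, rfl⟩
  exact (hm ⟨x, rfl⟩).trans (hD.le_piece j x)

/-- The stopping test is sufficient for global optimality. -/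
theorem Represents.isGlobalMin (hD : D.Represents f) (hb : BddBelow (range f)) {x : E d}
    (hx : ∀ j, 0 ≤ D.aj j x) (y : E d) : f x ≤ f y := by
  obtain ⟨j, hj⟩ := hD.exists_eq_piece y
  rw [hj]
  exact hD.le_piece_of_aj_nonneg (hD.bddBelow_piece hb j) (hx j) y

theorem Represents.eventually_aj_nonneg (hD : D.Represents f) (hb : BddBelow (range f))
    {x : ℕ → E d} (hanti : Antitone fun n => f (x n)) (j : Fin D.s)
    (hstep : ∀ n, D.aj j (x n) < 0 →
      f (x (n + 1)) ≤ f (x n + (D.aj j (x n))⁻¹ • D.vj j (x n))) :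
    ∀ᶠ n in atTop, 0 ≤ D.aj j (x n) := by
  obtain ⟨c, hc, hdec⟩ := hD.exists_decrease j
  -- Once a step reaches a minimizer of `g_j`, all later values of `f` are at most `min g_j`, so a
  -- further strict decrease of `g_j` below them is impossible. If this never happens, every failure
  -- of the test costs `c`, whereas consecutive differences of `f (x n)` tend to zero.
  by_cases hmin : ∃ n, D.aj j (x n) < 0 ∧
      ∀ y, D.piece j (x n + (D.aj j (x n))⁻¹ • D.vj j (x n)) ≤ D.piece j y
  · obtain ⟨n, hn, hmin⟩ := hmin
    filter_upwards [eventually_ge_atTop (n + 1)] with m hm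
    by_contra! hneg
    have h1 := (hdec _ hneg).1
    have h2 := hmin (x m + (D.aj j (x m))⁻¹ • D.vj j (x m))
    have h3 := (hanti hm).trans ((hstep n hn).trans (hD.le_piece j _))
    linarith
  · have hlim := tendsto_atTop_ciInf hanti (hb.mono (by rintro _ ⟨n, rfl⟩; exact ⟨_, rfl⟩))
    have h0 := hlim.sub (hlim.comp (tendsto_add_atTop_nat 1))
    rw [sub_self] at h0
    filter_upwards [h0.eventually_lt_const hc] with n hn
    by_contra! hneg
    have h1 := (hstep n hneg).trans (hD.le_piece j _)
    rcases (hdec _ hneg).2 with h | h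
    · exact hmin ⟨n, hneg, h⟩
    · simp only [Function.comp_apply] at hn
      linarith

/-- Any descent sequence doing at least as well as the steps `x + a_j(x)⁻¹ v_j(x)` finds a global
minimizer in finitely many iterations. -/
theorem Represents.findsGlobalMinimizer (hD : D.Represents f) (hb : BddBelow (range f))
    {x : ℕ → E d} (hanti : ∀ n, f (x (n + 1)) ≤ f (x n))
    (hstep : ∀ n j, D.aj j (x n) < 0 →
      f (x (n + 1)) ≤ f (x n + (D.aj j (x n))⁻¹ • D.vj j (x n))) :
    FindsGlobalMinimizer f D x := by
  have h := eventually_all.2 fun j => hD.eventually_aj_nonneg hb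
    (antitone_nat_of_succ_le hanti) j fun n => hstep n j
  obtain ⟨N, hN⟩ := eventually_atTop.1 h
  exact ⟨N, fun n hn => ⟨hN n hn, hD.isGlobalMin hb (hN n hn)⟩⟩

/-- Attainment follows from finite convergence: iterate the best of the finitely many candidate
steps. -/
theorem Represents.exists_isGlobalMin (hD : D.Represents f) (hb : BddBelow (range f)) :
    ∃ x, ∀ y, f x ≤ f y := by
  have hnext : ∀ x, ∃ y, f y ≤ f x ∧ ∀ j, f y ≤ f (x + (D.aj j x)⁻¹ • D.vj j x) := by
    intro x
    -- `none` stands for staying at `x`, which ensures descent.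
    obtain ⟨o, ho⟩ := Finite.exists_min fun o : Option (Fin D.s) =>
      f (o.elim x fun j => x + (D.aj j x)⁻¹ • D.vj j x)
    exact ⟨_, ho none, fun j => ho (some j)⟩
  choose next h1 h2 using hnext
  obtain ⟨N, hN⟩ := hD.findsGlobalMinimizer hb (x := fun n => next^[n] 0)
    (fun n => by rw [Function.iterate_succ_apply']; exact h1 _)
    (fun n j _ => by rw [Function.iterate_succ_apply']; exact h2 _ j)
  exact ⟨_, (hN N le_rfl).2⟩

theorem Represents.exists_isMCDStep (hD : D.Represents f) (hb : BddBelow (range f)) (x : E d) :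
    ∃ y, IsMCDStep f (D.hypodiff x) (range fun j => D.z j x) ⊤ x y := by
  have hp : ∀ z : EPlus d, ∃ p : EPlus d, z ∈ (range fun j => D.z j x) →
      IsLeastNorm (translate (D.hypodiff x) z) p := by
    intro z
    by_cases hz : z ∈ range fun j => D.z j x
    · obtain ⟨j, rfl⟩ := hz
      exact ⟨_, fun _ => D.nearest_isLeastNorm j x⟩
    · exact ⟨0, fun h => absurd h hz⟩
  choose p hp using hp
  choose α hα using fun z => hD.exists_line_search hb x (p z).snd
  obtain ⟨z₀, hz₀, hmin⟩ := (finite_range fun j => D.z j x).exists_minimalFor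
    (fun z => f (x - α z • (p z).snd)) _ ⟨_, ⟨0, D.s_pos⟩, rfl⟩
  exact ⟨_, p, α, fun z hz _ => hp z hz, fun z _ _ => hα z, z₀, hz₀, le_top,
    fun z hz _ => (le_total _ _).elim id fun h => hmin hz h, rfl⟩

/-- A step of the method of codifferential descent decreases `f` at least as much as any of the
steps `x + a_j(x)⁻¹ v_j(x)` with `a_j(x) < 0`. -/
theorem le_of_isMCDStep {x y : E d}
    (h : IsMCDStep f (D.hypodiff x) (range fun j => D.z j x) ⊤ x y) :
    f y ≤ f x ∧ ∀ j, D.aj j x < 0 → f y ≤ f (x + (D.aj j x)⁻¹ • D.vj j x) := by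
  obtain ⟨p, α, hp, hα, z₀, hz₀, -, hmin, rfl⟩ := h
  refine ⟨by simpa using (hα z₀ hz₀ le_top).2 0 le_rfl, fun j hj => ?_⟩
  have hz : D.z j x ∈ range fun j => D.z j x := ⟨j, rfl⟩
  refine (hmin _ hz le_top).trans ?_
  -- Since `a_j(x) < 0`, the step `-1 / a_j(x)` along `-v_j(x)` is admissible in the line search.
  have h1 := (hα _ hz le_top).2 (-(D.aj j x)⁻¹) (neg_nonneg.2 (inv_nonpos.2 hj.le))
  rw [neg_smul, sub_neg_eq_add, D.eq_nearest j x _ (hp _ hz le_top)] at h1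
  rwa [D.eq_nearest j x _ (hp _ hz le_top)]

end DCData

end PiecewiseAffine

open PiecewiseAffine in
theorem mainTheorem4 {d : ℕ} (f : E d → ℝ) (hf : IsPiecewiseAffine f)
    (hbdd : BddBelow (Set.range f)) :
    (∃ D : DCData d, D.Represents f) ∧
    (∃ xmin, ∀ y, f xmin ≤ f y) ∧
    ∀ D : DCData d, D.Represents f →
      (∀ x : ℕ → E d,
        (∀ n, f (x (n + 1)) ≤ f (x n)) →
        (∀ n j, D.aj j (x n) < 0 →
          f (x (n + 1)) ≤ f (x n + (D.aj j (x n))⁻¹ • D.vj j (x n))) →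
        FindsGlobalMinimizer f D x) ∧
      (∀ x₀ : E d, ∃ x : ℕ → E d, x 0 = x₀ ∧ IsMCDSequence f D x) ∧
      (∀ x : ℕ → E d, IsMCDSequence f D x → FindsGlobalMinimizer f D x) := by
  obtain ⟨D₀, hD₀⟩ := hf.isDCAffine.exists_represents
  refine ⟨⟨D₀, hD₀⟩, hD₀.exists_isGlobalMin hbdd, fun D hD =>
    ⟨fun x hanti hstep => hD.findsGlobalMinimizer hbdd hanti hstep, fun x₀ => ?_, fun x hx => ?_⟩⟩
  · choose next hnext using hD.exists_isMCDStep hbdd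
    refine ⟨fun n => next^[n] x₀, rfl, fun n => ?_⟩
    beta_reduce
    rw [Function.iterate_succ_apply']
    exact hnext _
  · exact hD.findsGlobalMinimizer hbdd (fun n => (DCData.le_of_isMCDStep (hx n)).1)
      fun n => (DCData.le_of_isMCDStep (hx n)).2
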